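/- Let $(X,d_X)$ be a locally compact separable metric space and $\mu$ a Borel measure on $X$ with $0<\mu(B(x,r))<\infty$ for every $x\in X$ and $r>0$. Let $\mathcal{M}$ be the set of all finite non-negative Borel measures $\nu$ on $X$ with compact support and $\nu\le\mu$, and write $\|\nu\|=\nu(X)$. Let $h:[0,\infty)\to[0,\infty)$ be a strictly increasing continuous function with $h(0)=\lim_{\varepsilon\to0^+}h(\varepsilon)/\varepsilon=0$, $h(\varepsilon_1)+h(\varepsilon_2)\le h(\varepsilon_1+\varepsilon_2)$ for all $\varepsilon_1,\varepsilon_2\ge0$, and $\lim_{\varepsilon\to\infty}h(\varepsilon)=\infty$. For $\nu,\eta\in\mathcal{M}$ let $d_{\mathcal{M}}(\nu,\eta)$ be the infimum of all $\varepsilon>0$ for which there are an at most countable index set $I$ and measures $\nu_i,\eta_i\in\mathcal{M}$ $(i\in I)$ such that $$\nu=\sum_{i\in I}\nu_i,\qquad \eta=\sum_{i\in I}\eta_i,\qquad \sum_{i\in I}\bigl|\|\nu_i\|-\|\eta_i\|\bigr|\le h(\varepsilon),$$ $$\operatorname{diam}\bigl(\operatorname{supp}(\nu_i)\cup\operatorname{supp}(\eta_i)\bigr)\le\varepsilon\quad\text{for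 every } i\in I.$$ For $b\ge0$ let $\widetilde{\mathcal{R}}_b(\mathcal{M})$ be the set of all rectifiable curves subparametrized by arc-length on $[0,b]$, that is, of all maps $\eta:[0,b]\to\mathcal{M}$ of finite $d_{\mathcal{M}}$-length with $d_{\mathcal{M}}(\eta(s'),\eta(s))\le s'-s$ for all $0\le s\le s'\le b$. Suppose that $\mathbb{M}$ is an at most countable set, $b\ge 0$, $\eta\in\widetilde{\mathcal{R}}_b(\mathcal{M})$, $t\in[0,b]$, and $\gamma_i\in\mathcal{M}$ $(i\in\mathbb{M})$ satisfy $\eta(t)=\sum_{i\in\mathbb{M}}\gamma_i$. Then there are curves $\eta_i\in\widetilde{\mathcal{R}}_b(\mathcal{M})$ $(i\in\mathbb{M})$ such that 1. $\eta_i(t)=\gamma_i$ for every $i\in\mathbb{M}$, and 2. $\eta(s)=\sum_{i\in\mathbb{M}}\eta_i(s)$ for every $s\in[0,b]$. -/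

import Mathlib

open MeasureTheory Set Filter Topology
open scoped NNReal ENNReal

namespace SubMeas

/-- The standing assumptions on a gauge `h : [0, ∞) → [0, ∞)`: it is strictly increasing and
continuous, `h 0 = 0`, `h ε / ε → 0` as `ε → 0+`, it is superadditive, and `h ε → ∞` as
`ε → ∞`. -/
structure IsGauge (h : ℝ≥0 → ℝ≥0) : Prop where
  strictMono : StrictMono h
  continuous : Continuous h
  map_zero : h 0 = 0
  tendsto_div : Tendsto (fun ε : ℝ≥0 => h ε / ε) (𝓝[>] 0) (𝓝 0)
  superadditive : ∀ a b : ℝ≥0, h a + h b ≤ h (a + b)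
  tendsto_atTop : Tendsto h atTop atTop

section Measures

variable {X : Type*} [MetricSpace X] [MeasurableSpace X]

/-- The set of all finite measures on `X` with compact support. -/
def compactlySupported (X : Type*) [MetricSpace X] [MeasurableSpace X] : Set (Measure X) :=
  {ν | IsFiniteMeasure ν ∧ IsCompact ν.support}

/-- The set of all finite measures `ν` with compact support and `0 ≤ ν ≤ μ`. -/
def dominated (μ : Measure X) : Set (Measure X) :=
  {ν | ν ∈ compactlySupported X ∧ ν ≤ μ}

/-- The total mass of a finite measure. -/
noncomputable def mass (ν : Measure X) : ℝ := ν.real univ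

/-- `IsDecomp μ ε δ ν η νs ηs` says that the (countable) family of pairs `(νs i, ηs i)` belongs
to `Γ_{ε,δ}(ν, η)`. -/
structure IsDecomp (μ : Measure X) (ε δ : ℝ≥0) (ν η : dominated μ) {M : Type*}
    (νs ηs : M → dominated μ) : Prop where
  sum_left : (ν : Measure X) = Measure.sum fun i => (νs i : Measure X)
  sum_right : (η : Measure X) = Measure.sum fun i => (ηs i : Measure X)
  mass_le : ∑' i, ENNReal.ofReal |mass (νs i : Measure X) - mass (ηs i : Measure X)| ≤ (δ : ℝ≥0∞)
  diam_le : ∀ i, Metric.ediam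
    ((νs i : Measure X).support ∪ (ηs i : Measure X).support) ≤ (ε : ℝ≥0∞)

/-- `Γ_{ε,δ}(ν, η)` is non-empty. Every countable index set has a copy in `Type`. -/
def HasDecomp (μ : Measure X) (ε δ : ℝ≥0) (ν η : dominated μ) : Prop :=
  ∃ (M : Type) (_ : Countable M) (νs ηs : M → dominated μ), IsDecomp μ ε δ ν η νs ηs

/-- The distance on `dominated μ`: the infimum of all `ε > 0` for which `Γ_{ε,h(ε)}(ν, η)` is
non-empty. The infimum is taken in `[0, ∞]`. -/
noncomputable def dominatedDist (μ : Measure X) (h : ℝ≥0 → ℝ≥0) (ν η : dominated μ) : ℝ≥0∞ :=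
  ⨅ (ε : ℝ≥0) (_ : 0 < ε ∧ HasDecomp μ ε (h ε) ν η), (ε : ℝ≥0∞)

end Measures

section Curves

variable {Y : Type*}

/-- The length of a map `γ : [a, b] → Y` with respect to the distance `d`. -/
noncomputable def curveLength (d : Y → Y → ℝ≥0∞) {a b : ℝ} (γ : Icc a b → Y) : ℝ≥0∞ :=
  ⨆ (k : ℕ) (u : {u : ℕ → Icc a b // Monotone u}),
    ∑ i ∈ Finset.range (k + 1), d (γ (u.1 (i + 1))) (γ (u.1 i))

/-- Rectifiable curves `[a, b] → Y` subparametrized by arc-length: maps of finite length that are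
`1`-Lipschitz. -/
structure IsSubparamCurve (d : Y → Y → ℝ≥0∞) {a b : ℝ} (γ : Icc a b → Y) : Prop where
  rectifiable : curveLength d γ < ∞
  lipschitz : ∀ s t : Icc a b, s ≤ t → d (γ t) (γ s) ≤ ENNReal.ofReal ((t : ℝ) - (s : ℝ))

end Curves

end SubMeas

/-! Since `h ε / ε → 0`, a curve subparametrized by arc-length transports mass without loss. Cutting
a time interval of length `c` into `n` equal steps makes the total mass defect about `n * h (c /
n)`, which tends to zero, while the displacements add up to `c`. So times `s`, `s'` are coupled with
displacement `|s - s'| + e` and defect `e` for every `e > 0` (`IsSubparamCurve.coupled`).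
Conversely, such couplings bound the distance by `|s - s'|` (`dominatedDist_le_of_coupled`), so it
suffices to split the couplings.

A splitting at one time is carried along a coupling by dividing each target piece in the proportions
of its source piece (`Coupled.exists_split`), and couplings compose (`Coupled.trans`). This splits
the curve at finitely many times, moving outwards from `t` (`exists_finite_splitting`). All pieces
at time `s` lie below the finite measure `η s`, so setwise limits along an ultrafilter exist and
keep the couplings (`exists_splitting`). An infinite sum could lose mass in the limit; conservation
of mass along each piece excludes this. -/

namespace SubMeas

/-! ### Common refinements and proportional splitting of measures -/

section Refinement

variable {X : Type*} [MeasurableSpace X]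

/-- Two countable decompositions of a finite measure have a common refinement. -/
theorem exists_common_refinement {I J : Type*} [Countable I] [Countable J] {ν : Measure X}
    [IsFiniteMeasure ν] {α : I → Measure X} {β : J → Measure X}
    (hα : ν = Measure.sum α) (hβ : ν = Measure.sum β) :
    ∃ ρ : I → J → Measure X, (∀ i, α i = Measure.sum (ρ i)) ∧
      ∀ j, β j = Measure.sum fun i => ρ i j := by
  have hαν : ∀ i, α i ≤ ν := fun i => hα ▸ Measure.le_sum α i
  have hβν : ∀ j, β j ≤ ν := fun j => hβ ▸ Measure.le_sum β j
  have hfin : ∀ i, IsFiniteMeasure (α i) := fun i => isFiniteMeasure_of_le ν (hαν i)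
  have hd : ∀ i, ν.withDensity ((α i).rnDeriv ν) = α i := fun i =>
    Measure.withDensity_rnDeriv_eq _ _ (hαν i).absolutelyContinuous
  have hm : ∀ i, Measurable ((α i).rnDeriv ν) := fun i => Measure.measurable_rnDeriv _ _
  have hmsum : Measurable (∑' i, (α i).rnDeriv ν) := by
    have : (∑' i, (α i).rnDeriv ν) = fun x => ∑' i, (α i).rnDeriv ν x := by
      ext x
      exact tsum_apply (Pi.summable.2 fun _ => ENNReal.summable)
    rw [this]
    exact Measurable.tsum hm
  have hone : (∑' i, (α i).rnDeriv ν) =ᵐ[ν] 1 := by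
    rw [← withDensity_eq_iff_of_sigmaFinite hmsum.aemeasurable (g := 1) aemeasurable_const, withDensity_one,
      withDensity_tsum hm]
    simp_rw [hd]
    exact hα.symm
  -- The densities of the `α i` form a partition of unity `ν`-a.e., hence `β j`-a.e.
  refine ⟨fun i j => (β j).withDensity ((α i).rnDeriv ν), fun i => ?_, fun j => ?_⟩
  · rw [← withDensity_sum, ← hβ, hd]
  · rw [← withDensity_tsum hm, withDensity_congr_ae ((hβν j).absolutelyContinuous.ae_eq hone),
      withDensity_one]

/-- The relative masses of the parts of a finite measure, the whole weight being put on a given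
part when the measure vanishes. -/
theorem exists_weights {I : Type*} [Countable I] {α : Measure X} [IsFiniteMeasure α]
    {ρ : I → Measure X} (hρ : α = Measure.sum ρ) (i₀ : I) :
    ∃ w : I → ℝ≥0∞, ∑' i, w i = 1 ∧ (∀ i, ρ i univ = w i * α univ) ∧
      ∀ i, i ≠ i₀ → ρ i = 0 → w i = 0 := by
  classical
  have hs : ∑' i, ρ i univ = α univ := by
    conv_rhs => rw [hρ]
    exact (Measure.sum_apply ρ MeasurableSet.univ).symm
  by_cases h0 : α univ = 0
  · refine ⟨Pi.single i₀ 1, tsum_pi_single _ _, fun i => ?_, fun i hi _ => Pi.single_eq_of_ne hi _⟩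
    rw [h0, mul_zero]
    exact le_antisymm (h0 ▸ hs ▸ ENNReal.le_tsum i) zero_le
  · refine ⟨fun i => ρ i univ / α univ, ?_, fun i => ?_, fun i _ hi => by simp [hi]⟩
    · simp_rw [div_eq_mul_inv]
      rw [ENNReal.tsum_mul_right, hs, ENNReal.mul_inv_cancel h0 (measure_ne_top _ _)]
    · rw [ENNReal.div_mul_cancel h0 (measure_ne_top _ _)]

theorem edist_real_smul (w : ℝ≥0∞) (hw : w ≠ ∞) (α β : Measure X) :
    edist ((w • α).real univ) ((w • β).real univ) = w * edist (α.real univ) (β.real univ) := by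
  lift w to ℝ≥0 using hw
  simp only [edist_dist, Real.dist_eq, measureReal_ennreal_smul_apply, ← mul_sub, abs_mul]
  rw [ENNReal.ofReal_mul (abs_nonneg _)]
  simp

theorem sum_smul_of_tsum_eq_one {I : Type*} [Countable I] {w : I → ℝ≥0∞} (hw : ∑' i, w i = 1)
    (α : Measure X) : α = Measure.sum fun i => w i • α := by
  ext s hs
  rw [Measure.sum_apply _ hs]
  simp [ENNReal.tsum_mul_right, hw]

theorem edist_real_sum_le {J : Type*} [Countable J] {νs ηs : J → Measure X}
    [IsFiniteMeasure (Measure.sum νs)] [IsFiniteMeasure (Measure.sum ηs)] :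
    edist ((Measure.sum νs).real univ) ((Measure.sum ηs).real univ) ≤
      ∑' j, edist ((νs j).real univ) ((ηs j).real univ) := by
  have key : ∀ (ζ : J → Measure X) [IsFiniteMeasure (Measure.sum ζ)],
      HasSum (fun j => (ζ j).real univ) ((Measure.sum ζ).real univ) := fun ζ _ => by
    have h1 : ∑' j, ζ j univ = Measure.sum ζ univ := (Measure.sum_apply _ MeasurableSet.univ).symm
    have h2 : ∑' j, ζ j univ ≠ ∞ := h1 ▸ measure_ne_top _ _
    have := ENNReal.hasSum_toReal h2
    rwa [← ENNReal.tsum_toReal_eq fun j => ENNReal.ne_top_of_tsum_ne_top h2 j, h1] at this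
  have h := (key νs).sub (key ηs)
  rw [edist_dist, dist_eq_norm, ofReal_norm, ← h.tsum_eq]
  simp_rw [edist_dist, dist_eq_norm, ofReal_norm]
  exact enorm_tsum_le_tsum_enorm

end Refinement

/-! ### Couplings: transport with bounded displacement and mass defect -/

section Coupled

variable {X : Type*} [MetricSpace X] [MeasurableSpace X]

/-- `Coupled ε δ ν η` says that `ν` and `η` have countable decompositions into corresponding parts
whose supports lie within sets of diameter at most `ε`, with total mass defect at most `δ`. -/
def Coupled (ε δ : ℝ≥0∞) (ν η : Measure X) : Prop :=
  ∃ (J : Type) (_ : Countable J) (νs ηs : J → Measure X),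
    ν = Measure.sum νs ∧ η = Measure.sum ηs ∧
    ∑' j, edist ((νs j).real univ) ((ηs j).real univ) ≤ δ ∧
    ∀ j, Metric.ediam ((νs j).support ∪ (ηs j).support) ≤ ε

theorem Coupled.mono {ε ε' δ δ' : ℝ≥0∞} {ν η : Measure X} (h : Coupled ε δ ν η) (hε : ε ≤ ε')
    (hδ : δ ≤ δ') : Coupled ε' δ' ν η := by
  obtain ⟨J, hJ, νs, ηs, h1, h2, h3, h4⟩ := h
  exact ⟨J, hJ, νs, ηs, h1, h2, h3.trans hδ, fun j => (h4 j).trans hε⟩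

theorem Coupled.symm {ε δ : ℝ≥0∞} {ν η : Measure X} (h : Coupled ε δ ν η) : Coupled ε δ η ν := by
  obtain ⟨J, hJ, νs, ηs, h1, h2, h3, h4⟩ := h
  refine ⟨J, hJ, ηs, νs, h2, h1, ?_, fun j => ?_⟩
  · simpa only [edist_comm] using h3
  · rw [union_comm]
    exact h4 j

/-- The decompositions may be assumed to contain a pair of zero measures. -/
theorem Coupled.exists_option {ε δ : ℝ≥0∞} {ν η : Measure X} (h : Coupled ε δ ν η) :
    ∃ (J : Type) (_ : Countable J) (νs ηs : Option J → Measure X),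
      ν = Measure.sum νs ∧ η = Measure.sum ηs ∧
      ∑' j, edist ((νs j).real univ) ((ηs j).real univ) ≤ δ ∧
      (∀ j, Metric.ediam ((νs j).support ∪ (ηs j).support) ≤ ε) ∧
      νs none = 0 ∧ ηs none = 0 := by
  obtain ⟨J, hJ, νs, ηs, h1, h2, h3, h4⟩ := h
  have hsum : ∀ νs : J → Measure X,
      Measure.sum νs = Measure.sum fun j : Option J => j.elim 0 νs := fun νs => by
    ext s hs
    rw [Measure.sum_apply _ hs, Measure.sum_apply _ hs]
    refine (Option.some_injective J).tsum_eq (f := fun i => i.elim (0 : Measure X) νs s) ?_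
    rintro (_ | j) hj
    · simp at hj
    · exact mem_range_self j
  refine ⟨J, hJ, fun j => j.elim 0 νs, fun j => j.elim 0 ηs, h1.trans (hsum _),
    h2.trans (hsum _), ?_, ?_, rfl, rfl⟩
  · refine le_trans (le_of_eq (Eq.symm ?_)) h3
    refine (Option.some_injective J).tsum_eq
      (f := fun j => edist ((j.elim (0 : Measure X) νs).real univ) ((j.elim 0 ηs).real univ)) ?_
    rintro (_ | j) hj
    · simp at hj
    · exact mem_range_self j
  · rintro (_ | j)
    · simp
    · exact h4 j

theorem Coupled.edist_real_le {ε δ : ℝ≥0∞} {ν η : Measure X} [IsFiniteMeasure ν]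
    [IsFiniteMeasure η] (h : Coupled ε δ ν η) : edist (ν.real univ) (η.real univ) ≤ δ := by
  obtain ⟨J, hJ, νs, ηs, rfl, rfl, h3, -⟩ := h
  exact edist_real_sum_le.trans h3

theorem support_smul_subset (w : ℝ≥0∞) (α : Measure X) : (w • α).support ⊆ α.support :=
  (Measure.smul_absolutelyContinuous).support_mono

/-- A decomposition of the first of two coupled measures is carried over to the second. -/
theorem Coupled.exists_split {I : Type*} [Countable I] [Nonempty I] {ε δ : ℝ≥0∞}
    {ν η : Measure X} [IsFiniteMeasure ν] (h : Coupled ε δ ν η) {γ : I → Measure X}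
    (hγ : ν = Measure.sum γ) :
    ∃ γ' : I → Measure X, η = Measure.sum γ' ∧ ∀ i, Coupled ε δ (γ i) (γ' i) := by
  obtain ⟨J, hJ, νs, ηs, h1, h2, h3, h4⟩ := h
  obtain ⟨ρ, hρ1, hρ2⟩ := exists_common_refinement hγ h1
  have hfin : ∀ j, IsFiniteMeasure (νs j) := fun j =>
    isFiniteMeasure_of_le ν (h1 ▸ Measure.le_sum νs j)
  -- `w j i` is the share of `νs j` lying in `γ i`. If `νs j` vanishes, all of `ηs j` goes to one
  -- arbitrary index.
  choose w hw1 hw2 _ using fun j => exists_weights (hρ2 j) (Classical.arbitrary I)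
  have hle : ∀ j i, w j i ≤ 1 := fun j i => hw1 j ▸ ENNReal.le_tsum i
  refine ⟨fun i => Measure.sum fun j => w j i • ηs j, ?_, fun i =>
    ⟨J, hJ, ρ i, fun j => w j i • ηs j, hρ1 i, rfl, ?_, fun j => ?_⟩⟩
  · rw [Measure.sum_comm, h2]
    congr 1
    ext1 j
    exact sum_smul_of_tsum_eq_one (hw1 j) _
  · refine le_trans (ENNReal.tsum_le_tsum fun j => ?_) h3
    have : (ρ i j).real univ = (w j i • νs j).real univ := by
      simp [Measure.real, hw2 j i]
    rw [this, edist_real_smul _ ((hle j i).trans_lt ENNReal.one_lt_top).ne]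
    exact mul_le_of_le_one_left zero_le (hle j i)
  · refine (Metric.ediam_mono (union_subset_union ?_ (support_smul_subset _ _))).trans (h4 j)
    exact Measure.support_mono (hρ2 j ▸ Measure.le_sum (fun i => ρ i j) i)

variable [SecondCountableTopology X]

/-- Gluing along the middle measure: if `ρ j k` is the common part of its pieces `ηs j` and `ηs' k`,
the outer pieces `νs j` and `θs k` are cut in proportion to the mass of `ρ j k`. If `ρ j k ≠ 0`, the
two middle supports meet, so diameters add. -/
theorem Coupled.trans {ε₁ ε₂ δ₁ δ₂ : ℝ≥0∞} {ν η θ : Measure X} [IsFiniteMeasure η]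
    (h : Coupled ε₁ δ₁ ν η) (h' : Coupled ε₂ δ₂ η θ) : Coupled (ε₁ + ε₂) (δ₁ + δ₂) ν θ := by
  obtain ⟨J, hJ, νs, ηs, h1, h2, h3, h4, -, -⟩ := h.exists_option
  obtain ⟨K, hK, ηs', θs, h1', h2', h3', h4', -, hθ0⟩ := h'.exists_option
  obtain ⟨ρ, hρ1, hρ2⟩ := exists_common_refinement h2 h1'
  have hfin : ∀ j, IsFiniteMeasure (ηs j) := fun j =>
    isFiniteMeasure_of_le η (h2 ▸ Measure.le_sum ηs j)
  have hfin' : ∀ j, IsFiniteMeasure (ηs' j) := fun j =>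
    isFiniteMeasure_of_le η (h1' ▸ Measure.le_sum ηs' j)
  -- The weight of a null `ηs j` goes to `none`, where `θs` is zero. Thus whenever `ρ j k = 0`, at
  -- least one outer piece vanishes and diameters need not add.
  choose w hw1 hw2 hw3 using fun j => exists_weights (hρ1 j) none
  choose v hv1 hv2 _ using fun k => exists_weights (hρ2 k) none
  have hw : ∀ j k, w j k ≠ ∞ := fun j k =>
    ((hw1 j ▸ ENNReal.le_tsum k : w j k ≤ 1).trans_lt ENNReal.one_lt_top).ne
  have hv : ∀ k j, v k j ≠ ∞ := fun k j =>
    ((hv1 k ▸ ENNReal.le_tsum j : v k j ≤ 1).trans_lt ENNReal.one_lt_top).ne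
  refine ⟨Option J × Option K, inferInstance, fun p => w p.1 p.2 • νs p.1,
    fun p => v p.2 p.1 • θs p.2, ?_, ?_, ?_, ?_⟩
  · ext s hs
    rw [h1, Measure.sum_apply _ hs, Measure.sum_apply _ hs, ENNReal.tsum_prod']
    simp [ENNReal.tsum_mul_right, hw1]
  · ext s hs
    rw [h2', Measure.sum_apply _ hs, Measure.sum_apply _ hs, ENNReal.tsum_prod', ENNReal.tsum_comm]
    simp [ENNReal.tsum_mul_right, hv1]
  · have hle : ∀ p : Option J × Option K,
        edist ((w p.1 p.2 • νs p.1).real univ) ((v p.2 p.1 • θs p.2).real univ) ≤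
          w p.1 p.2 * edist ((νs p.1).real univ) ((ηs p.1).real univ) +
            v p.2 p.1 * edist ((ηs' p.2).real univ) ((θs p.2).real univ) := fun p => by
      rw [← edist_real_smul _ (hw _ _), ← edist_real_smul _ (hv _ _)]
      have : (v p.2 p.1 • ηs' p.2).real univ = (w p.1 p.2 • ηs p.1).real univ := by
        simp only [Measure.real, Measure.smul_apply, smul_eq_mul, ← hw2, ← hv2]
      rw [this]
      exact edist_triangle _ _ _
    refine (ENNReal.tsum_le_tsum hle).trans ?_
    rw [ENNReal.tsum_add]
    refine add_le_add (le_trans (le_of_eq ?_) h3) (le_trans (le_of_eq ?_) h3')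
    · rw [ENNReal.tsum_prod']
      simp [ENNReal.tsum_mul_right, hw1]
    · rw [ENNReal.tsum_prod', ENNReal.tsum_comm]
      simp [ENNReal.tsum_mul_right, hv1]
  · rintro ⟨j, k⟩
    dsimp only
    rcases k with _ | k
    · rw [hθ0, smul_zero, Measure.support_zero, union_empty]
      refine ((Metric.ediam_mono ((support_smul_subset _ _).trans subset_union_left)).trans
        (h4 j)).trans le_self_add
    · by_cases h0 : ρ j (some k) = 0
      · rw [hw3 j _ (by simp) h0, zero_smul, Measure.support_zero, empty_union]
        exact ((Metric.ediam_mono ((support_smul_subset _ _).trans subset_union_right)).trans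
          (h4' _)).trans le_add_self
      · obtain ⟨x, hx⟩ := Measure.nonempty_support h0
        have hx1 : x ∈ (ηs j).support :=
          Measure.support_mono (hρ1 j ▸ Measure.le_sum (ρ j) (some k)) hx
        have hx2 : x ∈ (ηs' (some k)).support :=
          Measure.support_mono (hρ2 (some k) ▸ Measure.le_sum (fun j => ρ j (some k)) j) hx
        refine (Metric.ediam_mono (union_subset_union
          ((support_smul_subset _ _).trans subset_union_left)
          ((support_smul_subset _ _).trans subset_union_right))).trans
          ((Metric.ediam_union_le ⟨x, Or.inr hx1, Or.inl hx2⟩).trans (add_le_add (h4 j) (h4' _)))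

end Coupled

end SubMeas

namespace SubMeas

/-! ### Setwise limits of dominated measures -/

section SetwiseLimits

variable {X : Type*} [MeasurableSpace X] {K : Type*}

/-- Measures below a fixed finite measure converge setwise along every ultrafilter. -/
theorem exists_setwise_limit (U : Ultrafilter K) {ν : K → Measure X} {κ : Measure X}
    [IsFiniteMeasure κ] (hν : ∀ᶠ k in (U : Filter K), ν k ≤ κ) :
    ∃ ν' : Measure X, ν' ≤ κ ∧
      ∀ A, MeasurableSet A → Tendsto (fun k => ν k A) U (𝓝 (ν' A)) := by
  have hlim : ∀ A : Set X, ∃ c, Tendsto (fun k => ν k A) U (𝓝 c) := fun A => by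
    obtain ⟨c, -, hc⟩ := isCompact_univ.ultrafilter_le_nhds (U.map fun k => ν k A) (by simp)
    exact ⟨c, hc⟩
  choose m hm using hlim
  have hle : ∀ A, m A ≤ κ A := fun A =>
    le_of_tendsto (hm A) (hν.mono fun k hk => hk A)
  have hunion : ∀ ⦃f : ℕ → Set X⦄, (∀ i, MeasurableSet (f i)) → Pairwise (Function.onFun Disjoint f) →
      m (⋃ i, f i) = ∑' i, m (f i) := fun f hf hd => by
    have hfin : ∀ s : Finset ℕ,
        Tendsto (fun k => ∑ i ∈ s, ν k (f i)) U (𝓝 (∑ i ∈ s, m (f i))) :=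
      fun s => tendsto_finsetSum s fun i _ => hm (f i)
    have hκ : ∑' i, κ (f i) ≠ ∞ := by
      rw [← measure_iUnion hd hf]
      exact measure_ne_top _ _
    apply le_antisymm
    -- Domination by `κ` makes the tails small uniformly in `k`; this gives countable additivity of
    -- the limit.
    · have htail : ∀ n : ℕ, m (⋃ i, f i) ≤ ∑' i, m (f i) + ∑' i, κ (f (i + n)) := fun n => by
        have h1 : ∀ᶠ k in (U : Filter K),
            ν k (⋃ i, f i) ≤ ∑ i ∈ Finset.range n, ν k (f i) + ∑' i, κ (f (i + n)) := by
          filter_upwards [hν] with k hk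
          rw [measure_iUnion hd hf, ← ENNReal.summable.sum_add_tsum_nat_add' (k := n)]
          gcongr
        refine (le_of_tendsto_of_tendsto (hm _) ((hfin _).add_const _) h1).trans ?_
        gcongr
        exact ENNReal.sum_le_tsum _
      have := (ENNReal.tendsto_sum_nat_add _ hκ).const_add (∑' i, m (f i))
      rw [add_zero] at this
      exact ge_of_tendsto' this htail
    · refine ENNReal.tsum_le_of_sum_range_le fun n => ?_
      refine le_of_tendsto_of_tendsto' (hfin _) (hm _) fun k => ?_
      rw [measure_iUnion hd hf]
      exact ENNReal.sum_le_tsum _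
  have hempty : m ∅ = 0 := by simpa using hle ∅
  refine ⟨Measure.ofMeasurable (fun A _ => m A) hempty fun f hf hd => hunion hf hd, ?_, ?_⟩
  · refine Measure.le_iff.2 fun A hA => ?_
    rw [Measure.ofMeasurable_apply A hA]
    exact hle A
  · intro A hA
    rw [Measure.ofMeasurable_apply A hA]
    exact hm A

theorem measure_eq_of_setwise_limit {l : Filter K} [NeBot l] {ν : K → Measure X}
    {α β : Measure X} (hα : ∀ A, MeasurableSet A → Tendsto (fun k => ν k A) l (𝓝 (α A)))
    (hβ : ∀ A, MeasurableSet A → Tendsto (fun k => ν k A) l (𝓝 (β A))) : α = β :=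
  Measure.ext fun A hA => tendsto_nhds_unique (hα A hA) (hβ A hA)

/-- The sum of setwise limits is at most the limit of the sums. -/
theorem sum_setwise_limit_le {I : Type*} [Countable I] {l : Filter K} [NeBot l]
    {ν : I → K → Measure X} {α : I → Measure X} {κ : Measure X}
    (hα : ∀ i A, MeasurableSet A → Tendsto (fun k => ν i k A) l (𝓝 (α i A)))
    (hν : ∀ᶠ k in l, Measure.sum (fun i => ν i k) ≤ κ) : Measure.sum α ≤ κ := by
  refine Measure.le_iff.2 fun A hA => ?_
  rw [Measure.sum_apply _ hA]
  rw [ENNReal.tsum_eq_iSup_sum]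
  refine iSup_le fun s => ?_
  refine le_of_tendsto (tendsto_finsetSum s fun i _ => hα i A hA) ?_
  filter_upwards [hν] with k hk
  refine le_trans ?_ (hk A)
  rw [Measure.sum_apply _ hA]
  exact ENNReal.sum_le_tsum _

end SetwiseLimits

/-! ### Setwise convergence yields small couplings -/

section Closeness

variable {X : Type*} [MetricSpace X] [MeasurableSpace X] [BorelSpace X]
  [TopologicalSpace.SeparableSpace X] {K : Type*}

theorem edist_le_ofReal_of_mem_Icc {a b c : ℝ} (ha : a ∈ Icc 0 c) (hb : b ∈ Icc 0 c) :
    edist a b ≤ ENNReal.ofReal c := by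
  rw [edist_dist]
  refine ENNReal.ofReal_le_ofReal ?_
  simpa using Real.dist_le_of_mem_Icc ha hb

/-- Setwise convergence below a finite measure implies that the coupling errors tend to zero. -/
theorem eventually_coupled {l : Filter K} {ν : K → Measure X} {ν' κ : Measure X}
    [IsFiniteMeasure κ] (hν' : ν' ≤ κ) (hν : ∀ᶠ k in l, ν k ≤ κ)
    (hlim : ∀ A, MeasurableSet A → Tendsto (fun k => ν k A) l (𝓝 (ν' A)))
    {ε δ : ℝ≥0∞} (hε : 0 < ε) (hδ : 0 < δ) : ∀ᶠ k in l, Coupled ε δ ν' (ν k) := by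
  obtain ⟨r, hr0, hr⟩ := ENNReal.lt_iff_exists_nnreal_btwn.1 hε
  obtain ⟨A, hA, hbdd, hdiam, huniv, hdisj⟩ :=
    SeparableSpace.exists_measurable_partition_diam_le X (ε := r) (by exact_mod_cast hr0)
  have hsplit : ∀ α : Measure X, α = Measure.sum fun n => α.restrict (A n) := fun α => by
    rw [← Measure.restrict_iUnion hdisj hA, huniv, Measure.restrict_univ]
  have hAdiam : ∀ n, Metric.ediam (closure (A n)) ≤ ε := fun n => by
    rw [Metric.ediam_closure]
    refine Metric.ediam_le fun x hx y hy => le_trans ?_ hr.le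
    rw [edist_dist, ← ENNReal.ofReal_coe_nnreal]
    exact ENNReal.ofReal_le_ofReal ((Metric.dist_le_diam_of_mem (hbdd n) hx hy).trans (hdiam n))
  have hsum : ∑' n, κ (A n) ≠ ∞ := by
    rw [← measure_iUnion hdisj hA]
    exact measure_ne_top _ _
  have hδ2 : 0 < δ / 2 := ENNReal.half_pos hδ.ne'
  -- Both measures are cut along one partition into small sets: convergence controls the first `N`
  -- cells, and `κ` the rest.
  obtain ⟨N, hN⟩ := ((ENNReal.tendsto_sum_nat_add _ hsum).eventually_lt_const hδ2).exists
  have hreal : ∀ {α : Measure X}, α ≤ κ → ∀ n, α.real (A n) ∈ Icc 0 (κ.real (A n)) :=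
    fun hα n => ⟨measureReal_nonneg, ENNReal.toReal_mono (measure_ne_top _ _) (hα _)⟩
  have hhead : Tendsto (fun k => ∑ n ∈ Finset.range N, edist (ν'.real (A n)) ((ν k).real (A n))) l
      (𝓝 0) := by
    rw [← Finset.sum_const_zero (s := Finset.range N)]
    refine tendsto_finsetSum _ fun n _ => ?_
    have h1 : Tendsto (fun k => (ν k).real (A n)) l (𝓝 (ν'.real (A n))) :=
      (ENNReal.tendsto_toReal (ne_top_of_le_ne_top (measure_ne_top κ _) (hν' (A n)))).comp
        (hlim _ (hA n))
    simpa using (tendsto_const_nhds (x := ν'.real (A n))).edist h1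
  filter_upwards [hν, hhead.eventually_lt_const hδ2] with k hk hk2
  refine ⟨ℕ, inferInstance, fun n => ν'.restrict (A n), fun n => (ν k).restrict (A n),
    hsplit _, hsplit _, ?_, fun n => ?_⟩
  · simp only [measureReal_restrict_apply_univ]
    rw [← ENNReal.summable.sum_add_tsum_nat_add' (k := N), ← ENNReal.add_halves δ]
    refine add_le_add hk2.le ((ENNReal.tsum_le_tsum fun n => ?_).trans hN.le)
    refine (edist_le_ofReal_of_mem_Icc (hreal hν' _) (hreal hk _)).trans ?_
    exact ENNReal.ofReal_toReal_le
  · exact (Metric.ediam_mono (union_subset (Measure.support_restrict_subset.trans inter_subset_left)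
      (Measure.support_restrict_subset.trans inter_subset_left))).trans (hAdiam n)

end Closeness

end SubMeas

namespace SubMeas

/-! ### Splitting at finitely many times and passage to the limit -/

section Families

variable {X : Type*} [MetricSpace X] [MeasurableSpace X]

theorem measure_univ_eq_of_coupled {c : ℝ≥0∞} {ν η : Measure X} [IsFiniteMeasure ν]
    [IsFiniteMeasure η] (h : ∀ e : ℝ≥0, 0 < e → Coupled (c + e) e ν η) : ν univ = η univ := by
  have h0 : edist (ν.real univ) (η.real univ) = 0 := by
    refine le_antisymm (ENNReal.le_of_forall_pos_le_add fun e he _ => ?_) zero_le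
    simpa using (h e he).edist_real_le
  exact (measureReal_eq_measureReal_iff).1 (edist_eq_zero.1 h0)

theorem edist_add_edist_of_between {x y z : ℝ} (h : x ≤ y ∧ y ≤ z ∨ z ≤ y ∧ y ≤ x) :
    edist x z = edist x y + edist y z := by
  simp only [edist_dist, Real.dist_eq]
  rw [← ENNReal.ofReal_add (abs_nonneg _) (abs_nonneg _)]
  congr 1
  rcases h with ⟨h1, h2⟩ | ⟨h1, h2⟩
  · rw [abs_of_nonpos (by linarith), abs_of_nonpos (by linarith), abs_of_nonpos (by linarith)]
    ring
  · rw [abs_of_nonneg (by linarith), abs_of_nonneg (by linarith), abs_of_nonneg (by linarith)]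
    ring

/-- A point farthest from `t` has a neighbour in the rest of a finite set containing `t`. -/
theorem exists_neighbour {S : Set ℝ} {t a : S} {F : Finset S} (htF : t ∈ F) (hat : a ≠ t)
    (hF : ∀ s ∈ F, |(s : ℝ) - t| ≤ |(a : ℝ) - t|) :
    ∃ m ∈ F, ∀ s ∈ F, edist s a = edist s m + edist m a := by
  have hne : F.Nonempty := ⟨t, htF⟩
  rcases lt_or_gt_of_ne hat with hlt | hgt
  · refine ⟨F.min' hne, F.min'_mem hne, fun s hs => edist_add_edist_of_between (Or.inr ⟨?_, ?_⟩)⟩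
    · have h1 := hF _ (F.min'_mem hne)
      have h2 : (a : ℝ) < t := hlt
      rw [abs_of_neg (by linarith : (a : ℝ) - t < 0)] at h1
      linarith [neg_abs_le (((F.min' hne : S) : ℝ) - t)]
    · exact F.min'_le s hs
  · refine ⟨F.max' hne, F.max'_mem hne, fun s hs => edist_add_edist_of_between (Or.inl ⟨?_, ?_⟩)⟩
    · exact F.le_max' s hs
    · have h1 := hF _ (F.max'_mem hne)
      have h2 : (t : ℝ) < a := hgt
      rw [abs_of_pos (by linarith : 0 < (a : ℝ) - t)] at h1
      linarith [le_abs_self (((F.max' hne : S) : ℝ) - t)]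

variable [BorelSpace X] [TopologicalSpace.SeparableSpace X]

theorem Coupled.refl {ε δ : ℝ≥0∞} (hε : 0 < ε) (hδ : 0 < δ) (ν : Measure X) [IsFiniteMeasure ν] :
    Coupled ε δ ν ν :=
  (eventually_coupled (l := (pure () : Filter Unit)) (ν := fun _ => ν) le_rfl
    (Eventually.of_forall fun _ => le_rfl) (fun _ _ => tendsto_const_nhds) hε hδ : _)

/-- Splitting of a curve of measures at finitely many times. -/
theorem exists_finite_splitting {I : Type*} [Countable I] [Nonempty I] {S : Set ℝ}
    {u : S → Measure X} [∀ s, IsFiniteMeasure (u s)]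
    (hu : ∀ s s' : S, ∀ e : ℝ≥0, 0 < e → Coupled (edist s s' + e) e (u s) (u s'))
    {t : S} {γ : I → Measure X} (hγ : u t = Measure.sum γ) (F : Finset S) :
    ∀ e : ℝ≥0, 0 < e → ∃ σ : S → I → Measure X, σ t = γ ∧
      (∀ s ∈ insert t F, u s = Measure.sum (σ s)) ∧
      ∀ s ∈ insert t F, ∀ s' ∈ insert t F, ∀ i,
        Coupled (edist s s' + e) e (σ s i) (σ s' i) := by
  have : SecondCountableTopology X := UniformSpace.secondCountable_of_separable X
  have hfin : ∀ {s : S} {σ : I → Measure X}, u s = Measure.sum σ → ∀ i, IsFiniteMeasure (σ i) :=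
    fun {s σ} h i => isFiniteMeasure_of_le (u s) (h ▸ Measure.le_sum σ i)
  have hrefl : ∀ {s : S} {e : ℝ≥0}, 0 < e → ∀ {σ : I → Measure X}, u s = Measure.sum σ → ∀ i,
      Coupled (edist s s + e) e (σ i) (σ i) := fun {s e} he {σ} h i => by
    have := hfin h i
    have he' : (0 : ℝ≥0∞) < e := by exact_mod_cast he
    exact Coupled.refl (he'.trans_le le_add_self) he' _
  -- Times enter by increasing distance from `t`, so a new time `a` is extremal and its neighbour
  -- `m` lies between `a` and every earlier time. Going through `m` then adds no displacement, and
  -- each leg takes half of the error `e`.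
  induction F using Finset.induction_on_max_value fun s : S => |(s : ℝ) - t| with
  | empty =>
    refine fun e he => ⟨fun _ => γ, rfl, ?_, ?_⟩
    · simpa using hγ
    · intro s hs s' hs' i
      simp only [insert_empty_eq, Finset.mem_singleton] at hs hs'
      subst hs hs'
      exact hrefl he hγ i
  | insert a F haF hmax ih =>
    intro e he
    by_cases hat : a = t
    · have : insert t (insert a F) = insert t F := by
        rw [hat, Finset.insert_idem]
      rw [this]
      exact ih e he
    obtain ⟨σ, hσt, hσs, hσc⟩ := ih (e / 2) (half_pos he)
    have haF' : a ∉ insert t F := by simp [hat, haF]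
    obtain ⟨m, hm, hma⟩ := exists_neighbour (a := a) (Finset.mem_insert_self t F) hat (by
      intro s hs
      rcases Finset.mem_insert.1 hs with rfl | hs
      · simp
      · exact hmax s hs)
    obtain ⟨γ', hγ', hc⟩ := (hu m a (e / 2) (half_pos he)).exists_split (hσs m hm)
    have hne : ∀ {s}, s ∈ insert t F → s ≠ a := fun hs h => haF' (h ▸ hs)
    have hhalf : ((e / 2 : ℝ≥0) : ℝ≥0∞) + ((e / 2 : ℝ≥0) : ℝ≥0∞) = e := by
      rw [← ENNReal.coe_add, add_halves]
    have hto : ∀ s ∈ insert t F, ∀ i, Coupled (edist s a + e) e (σ s i) (γ' i) := fun s hs i => by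
      have := hfin (hσs m hm) i
      refine ((hσc s hs m hm i).trans (hc i)).mono (le_of_eq ?_) hhalf.le
      rw [add_add_add_comm, hhalf, hma s hs]
    rw [Finset.insert_comm]
    refine ⟨Function.update σ a γ', ?_, ?_, ?_⟩
    · rw [Function.update_of_ne (Ne.symm hat), hσt]
    · intro s hs
      rcases Finset.mem_insert.1 hs with rfl | hs
      · rwa [Function.update_self]
      · rw [Function.update_of_ne (hne hs)]
        exact hσs s hs
    · intro s hs s' hs' i
      rcases Finset.mem_insert.1 hs with rfl | hsF <;> rcases Finset.mem_insert.1 hs' with rfl | hsF'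
      · rw [Function.update_self]
        exact hrefl he hγ' i
      · rw [Function.update_self, Function.update_of_ne (hne hsF'), edist_comm]
        exact (hto s' hsF' i).symm
      · rw [Function.update_self, Function.update_of_ne (hne hsF)]
        exact hto s hsF i
      · rw [Function.update_of_ne (hne hsF'), Function.update_of_ne (hne hsF)]
        refine (hσc s hsF s' hsF' i).mono ?_ ?_
        · gcongr
          exact NNReal.half_le_self e
        · exact_mod_cast NNReal.half_le_self e

/-- Splitting of a curve of measures at all times. -/
theorem exists_splitting {I : Type*} [Countable I] [Nonempty I] {S : Set ℝ}
    {u : S → Measure X} [∀ s, IsFiniteMeasure (u s)]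
    (hu : ∀ s s' : S, ∀ e : ℝ≥0, 0 < e → Coupled (edist s s' + e) e (u s) (u s'))
    {t : S} {γ : I → Measure X} (hγ : u t = Measure.sum γ) :
    ∃ σ : S → I → Measure X, σ t = γ ∧ (∀ s, u s = Measure.sum (σ s)) ∧
      ∀ s s' i, ∀ e : ℝ≥0, 0 < e → Coupled (edist s s' + e) e (σ s i) (σ s' i) := by
  classical
  have : SecondCountableTopology X := UniformSpace.secondCountable_of_separable X
  choose τ hτt hτs hτc using fun k : Finset S × ℕ =>
    exists_finite_splitting hu hγ k.1 ((k.2 : ℝ≥0) + 1)⁻¹ (by positivity)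
  -- Along `U` every time is eventually among the split ones and the error tends to zero.
  let U : Ultrafilter (Finset S × ℕ) := Ultrafilter.of atTop
  have hU : (U : Filter (Finset S × ℕ)) ≤ atTop := Ultrafilter.of_le _
  have hmem : ∀ s, ∀ᶠ k in (U : Filter (Finset S × ℕ)), s ∈ insert t k.1 := fun s =>
    hU ((eventually_ge_atTop (({s}, 0) : Finset S × ℕ)).mono fun k hk =>
      Finset.mem_insert_of_mem (hk.1 (Finset.mem_singleton_self s)))
  have hsmall : ∀ e : ℝ≥0, 0 < e →
      ∀ᶠ k in (U : Filter (Finset S × ℕ)), ((k.2 : ℝ≥0) + 1)⁻¹ ≤ e := fun e he => by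
    obtain ⟨N, hN⟩ := exists_nat_ge e⁻¹
    refine hU ((eventually_ge_atTop ((∅, N) : Finset S × ℕ)).mono fun k hk => ?_)
    refine inv_le_of_inv_le₀ he (hN.trans (le_trans ?_ le_self_add))
    exact_mod_cast hk.2
  have hle : ∀ s i, ∀ᶠ k in (U : Filter (Finset S × ℕ)), τ k s i ≤ u s := fun s i =>
    (hmem s).mono fun k hk => hτs k s hk ▸ Measure.le_sum _ i
  choose σ hσle hσlim using fun s i => exists_setwise_limit U (hle s i)
  have hσfin : ∀ s i, IsFiniteMeasure (σ s i) := fun s i => isFiniteMeasure_of_le _ (hσle s i)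
  have hσt : σ t = γ := by
    funext i
    refine measure_eq_of_setwise_limit (hσlim t i) fun A _ => ?_
    simp only [hτt]
    exact tendsto_const_nhds
  have hσc : ∀ s s' i, ∀ e : ℝ≥0, 0 < e → Coupled (edist s s' + e) e (σ s i) (σ s' i) := by
    intro s s' i e he
    have he3 : 0 < e / 3 := by positivity
    have he3' : (0 : ℝ≥0∞) < ((e / 3 : ℝ≥0) : ℝ≥0∞) := by exact_mod_cast he3
    have hthird : ((e / 3 : ℝ≥0) : ℝ≥0∞) + (e / 3 : ℝ≥0) + (e / 3 : ℝ≥0) = e := by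
      norm_cast
      exact add_thirds e
    obtain ⟨k, hks, hks', hkl, hkl', hke, h1, h2⟩ :=
      ((hmem s).and ((hmem s').and ((hle s i).and ((hle s' i).and ((hsmall _ he3).and
        ((eventually_coupled (hσle s i) (hle s i) (hσlim s i) he3' he3').and
          (eventually_coupled (hσle s' i) (hle s' i) (hσlim s' i) he3' he3'))))))).exists
    have := isFiniteMeasure_of_le _ hkl
    have := isFiniteMeasure_of_le _ hkl'
    have hke' : ((((k.2 : ℝ≥0) + 1)⁻¹ : ℝ≥0) : ℝ≥0∞) ≤ ((e / 3 : ℝ≥0) : ℝ≥0∞) := by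
      exact_mod_cast hke
    refine ((h1.trans ((hτc k s hks s' hks' i).mono (add_le_add_right hke' _) hke')).trans
      h2.symm).mono (le_of_eq ?_) hthird.le
    rw [add_left_comm, add_assoc, hthird]
  refine ⟨σ, hσt, fun s => ?_, hσc⟩
  -- Only an inequality survives the limit. Equality follows by comparing total masses with those at
  -- time `t`, where the sum is exact.
  have hsum : Measure.sum (σ s) ≤ u s :=
    sum_setwise_limit_le (hσlim s) ((hmem s).mono fun k hk => (hτs k s hk).ge)
  have : IsFiniteMeasure (Measure.sum (σ s)) := isFiniteMeasure_of_le _ hsum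
  refine (Measure.eq_of_le_of_measure_univ_eq hsum ?_).symm
  rw [measure_univ_eq_of_coupled (hu s t), hγ, ← hσt, Measure.sum_apply _ MeasurableSet.univ,
    Measure.sum_apply _ MeasurableSet.univ]
  exact tsum_congr fun i => measure_univ_eq_of_coupled (hσc s t i)

end Families

/-! ### From the distance to couplings and back -/

section Dominated

variable {X : Type*} [MetricSpace X] [MeasurableSpace X] {μ : Measure X}

theorem mem_dominated_of_le {ν κ : Measure X} (hκ : κ ∈ dominated μ) (h : ν ≤ κ) :
    ν ∈ dominated μ := by
  have := hκ.1.1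
  exact ⟨⟨isFiniteMeasure_of_le κ h,
    hκ.1.2.of_isClosed_subset Measure.isClosed_support (Measure.support_mono h)⟩, h.trans hκ.2⟩

instance (ν : dominated μ) : IsFiniteMeasure (ν : Measure X) := ν.2.1.1

theorem HasDecomp.coupled {ε δ : ℝ≥0} {ν η : dominated μ} (h : HasDecomp μ ε δ ν η) :
    Coupled ε δ (ν : Measure X) (η : Measure X) := by
  obtain ⟨J, hJ, νs, ηs, h⟩ := h
  refine ⟨J, hJ, fun j => νs j, fun j => ηs j, h.sum_left, h.sum_right, ?_, h.diam_le⟩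
  simpa only [edist_dist, Real.dist_eq, mass] using h.mass_le

theorem Coupled.hasDecomp {ε δ : ℝ≥0} {ν η : dominated μ}
    (h : Coupled ε δ (ν : Measure X) (η : Measure X)) : HasDecomp μ ε δ ν η := by
  obtain ⟨J, hJ, νs, ηs, h1, h2, h3, h4⟩ := h
  refine ⟨J, hJ, fun j => ⟨νs j, mem_dominated_of_le ν.2 (h1 ▸ Measure.le_sum νs j)⟩,
    fun j => ⟨ηs j, mem_dominated_of_le η.2 (h2 ▸ Measure.le_sum ηs j)⟩, h1, h2, ?_, h4⟩
  simpa only [edist_dist, Real.dist_eq, mass] using h3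

variable {h : ℝ≥0 → ℝ≥0}

theorem coupled_of_dominatedDist_lt (hh : IsGauge h) {ν η : dominated μ} {ε : ℝ≥0}
    (hd : dominatedDist μ h ν η < ε) : Coupled ε (h ε) (ν : Measure X) (η : Measure X) := by
  simp only [dominatedDist, iInf_lt_iff] at hd
  obtain ⟨ε', ⟨-, hdec⟩, hlt⟩ := hd
  have hle : ε' ≤ ε := by exact_mod_cast hlt.le
  refine hdec.coupled.mono hlt.le ?_
  exact_mod_cast hh.strictMono.monotone hle

theorem dominatedDist_le_of_coupled (hh : IsGauge h) {ν η : dominated μ} {c : ℝ≥0∞}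
    (hc : ∀ e : ℝ≥0, 0 < e → Coupled (c + e) e (ν : Measure X) (η : Measure X)) :
    dominatedDist μ h ν η ≤ c := by
  refine ENNReal.le_of_forall_pos_le_add fun e he hct => ?_
  lift c to ℝ≥0 using hct.ne
  have hhe : 0 < h e := hh.map_zero ▸ hh.strictMono he
  have hdec : HasDecomp μ (c + e) (h (c + e)) ν η := by
    -- The minimum keeps the displacement below `c + e` and the defect below `h e ≤ h (c + e)`.
    refine ((hc (min e (h e)) (lt_min he hhe)).mono ?_ ?_).hasDecomp
    · exact_mod_cast add_le_add_right (min_le_left e (h e)) c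
    · exact_mod_cast (min_le_right e (h e)).trans (hh.strictMono.monotone le_add_self)
  exact_mod_cast iInf₂_le (f := fun (ε : ℝ≥0) (_ : 0 < ε ∧ HasDecomp μ ε (h ε) ν η) => (ε : ℝ≥0∞))
    (c + e) ⟨he.trans_le le_add_self, hdec⟩

/-- With `x = c / (n + 1)` the left side equals `c * (h x / x)`, which tends to zero. -/
theorem IsGauge.exists_nat_mul_le (hh : IsGauge h) {c e : ℝ≥0} (hc : 0 < c) (he : 0 < e) :
    ∃ n : ℕ, (n + 1) * h (c / (n + 1)) ≤ e := by
  have hlim : Tendsto (fun n : ℕ => c / ((n : ℝ≥0) + 1)) atTop (𝓝[>] 0) := by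
    refine tendsto_nhdsWithin_iff.2 ⟨?_, Eventually.of_forall fun n => ?_⟩
    · have := (tendsto_one_div_add_atTop_nhds_zero_nat (𝕜 := ℝ≥0)).const_mul c
      simpa only [mul_zero, mul_one_div] using this
    · exact div_pos hc (by positivity)
  obtain ⟨n, hn⟩ := ((hh.tendsto_div.comp hlim).eventually_lt_const (div_pos he hc)).exists
  refine ⟨n, ?_⟩
  have hn1 : (0 : ℝ≥0) < n + 1 := by positivity
  have : (n + 1) * h (c / (n + 1)) = c * (h (c / (n + 1)) / (c / (n + 1))) := by
    field_simp
  rw [this]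
  calc c * (h (c / (n + 1)) / (c / (n + 1))) ≤ c * (e / c) := by
        exact mul_le_mul_right hn.le c
    _ = e := mul_div_cancel₀ e hc.ne'

theorem Coupled.chain [SecondCountableTopology X] {ε δ : ℝ≥0∞} {u : ℕ → Measure X}
    [∀ n, IsFiniteMeasure (u n)] (hu : ∀ n, Coupled ε δ (u n) (u (n + 1))) (n : ℕ) :
    Coupled ((n + 1) * ε) ((n + 1) * δ) (u 0) (u (n + 1)) := by
  induction n with
  | zero => simpa using hu 0
  | succ n ih =>
    have := ih.trans (hu (n + 1))
    push_cast
    rwa [add_mul _ 1 ε, add_mul _ 1 δ, one_mul, one_mul]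

theorem projIcc_add_sub_le {a b x r : ℝ} (hab : a ≤ b) (hr : 0 ≤ r) :
    (projIcc a b hab (x + r) : ℝ) - projIcc a b hab x ≤ r := by
  simp only [coe_projIcc]
  have h1 : min b (x + r) ≤ min b x + r := by
    rw [← min_add_add_right]
    exact min_le_min_right _ (by linarith)
  have h2 : max a (min b (x + r)) ≤ max a (min b x) + r :=
    max_le (by linarith [le_max_left a (min b x)]) (by linarith [le_max_right a (min b x)])
  linarith

/-- Along a curve subparametrized by arc-length mass is transported, with no mass defect. -/
theorem IsSubparamCurve.coupled [SecondCountableTopology X] (hh : IsGauge h) {a b : ℝ}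
    {η : Icc a b → dominated μ} (hη : IsSubparamCurve (dominatedDist μ h) η) (s s' : Icc a b)
    (e : ℝ≥0) (he : 0 < e) :
    Coupled (edist s s' + e) e (η s : Measure X) (η s' : Measure X) := by
  wlog hss : s ≤ s' generalizing s s'
  · rw [edist_comm]
    exact (this s' s (le_of_not_ge hss)).symm
  have hab : a ≤ b := s.2.1.trans s.2.2
  obtain ⟨d, hd⟩ : ∃ d : ℝ≥0, (d : ℝ) = s' - s := ⟨⟨s' - s, sub_nonneg.2 hss⟩, rfl⟩
  have hde : edist s s' = d := by
    rw [edist_comm, Subtype.edist_eq, edist_dist, Real.dist_eq, ← hd, NNReal.abs_eq,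
      ENNReal.ofReal_coe_nnreal]
  -- Enlarging `d` to `d + e` makes each step strictly longer than the distance it covers, even when
  -- `d = 0`.
  obtain ⟨n, hn⟩ := hh.exists_nat_mul_le (c := d + e) (he.trans_le le_add_self) he
  have hn1 : (0 : ℝ≥0) < n + 1 := by positivity
  -- The projection keeps the infinite sequence of times required by `Coupled.chain` inside the
  -- interval.
  have hstep : ∀ k : ℕ, Coupled ((d + e) / (n + 1) : ℝ≥0) (h ((d + e) / (n + 1)))
      (η (projIcc a b hab (s + k * (d / (n + 1) : ℝ≥0))) : Measure X)
      (η (projIcc a b hab (s + (k + 1 : ℕ) * (d / (n + 1) : ℝ≥0))) : Measure X) := fun k => by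
    refine (coupled_of_dominatedDist_lt hh ?_).symm
    have hr : (0 : ℝ) ≤ (d / (n + 1) : ℝ≥0) := NNReal.coe_nonneg _
    have hk : (s : ℝ) + (k + 1 : ℕ) * (d / (n + 1) : ℝ≥0) =
        s + k * (d / (n + 1) : ℝ≥0) + (d / (n + 1) : ℝ≥0) := by
      push_cast
      ring
    rw [hk]
    refine (hη.lipschitz _ _ (monotone_projIcc hab (le_add_of_nonneg_right hr))).trans_lt ?_
    refine (ENNReal.ofReal_le_ofReal (projIcc_add_sub_le hab hr)).trans_lt ?_
    rw [ENNReal.ofReal_coe_nnreal, ENNReal.coe_lt_coe]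
    exact div_lt_div_of_pos_right (lt_add_of_pos_right d he) hn1
  have hchain := Coupled.chain hstep n
  have hend : (s : ℝ) + (n + 1 : ℕ) * (d / (n + 1) : ℝ≥0) = s' := by
    push_cast
    rw [mul_div_cancel₀ _ (by positivity), hd]
    ring
  rw [hend, Nat.cast_zero, zero_mul, add_zero, projIcc_val, projIcc_val] at hchain
  rw [hde]
  refine hchain.mono (le_of_eq ?_) (by exact_mod_cast hn)
  have : ((n : ℝ≥0) + 1) * ((d + e) / (n + 1)) = d + e := mul_div_cancel₀ _ hn1.ne'
  exact_mod_cast this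

end Dominated

/-- Finite length is automatic: the bounds telescope to at most `b - a`. -/
theorem IsSubparamCurve.of_lipschitz {Y : Type*} {d : Y → Y → ℝ≥0∞} {a b : ℝ} {γ : Icc a b → Y}
    (h : ∀ s t : Icc a b, s ≤ t → d (γ t) (γ s) ≤ ENNReal.ofReal ((t : ℝ) - (s : ℝ))) :
    IsSubparamCurve d γ := by
  refine ⟨lt_of_le_of_lt (iSup₂_le fun k u => ?_) (ENNReal.ofReal_lt_top (r := b - a)), h⟩
  have hu : ∀ i, u.1 i ≤ u.1 (i + 1) := fun i => u.2 (Nat.le_succ i)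
  refine (Finset.sum_le_sum fun i _ => h _ _ (hu i)).trans ?_
  rw [← ENNReal.ofReal_sum_of_nonneg fun i _ => sub_nonneg.2 (hu i),
    Finset.sum_range_sub fun i => ((u.1 i : Icc a b) : ℝ)]
  exact ENNReal.ofReal_le_ofReal (sub_le_sub (u.1 _).2.2 (u.1 _).2.1)

end SubMeas

theorem mainTheorem8 {X : Type*} [MetricSpace X] [LocallyCompactSpace X]
    [TopologicalSpace.SeparableSpace X] [MeasurableSpace X] [BorelSpace X]
    (μ : Measure X)
    (hμ : ∀ (x : X) (r : ℝ), 0 < r → 0 < μ (Metric.ball x r) ∧ μ (Metric.ball x r) < ∞)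
    (h : ℝ≥0 → ℝ≥0) (hh : SubMeas.IsGauge h)
    {M : Type*} [Countable M]
    (b : ℝ) (hb : 0 ≤ b)
    (η : Icc (0 : ℝ) b → SubMeas.dominated μ)
    (hη : SubMeas.IsSubparamCurve (SubMeas.dominatedDist μ h) η)
    (t : Icc (0 : ℝ) b)
    (γ : M → SubMeas.dominated μ)
    (hγ : (η t : Measure X) = Measure.sum fun i => (γ i : Measure X)) :
    ∃ ηs : M → Icc (0 : ℝ) b → SubMeas.dominated μ,
      (∀ i, SubMeas.IsSubparamCurve (SubMeas.dominatedDist μ h) (ηs i)) ∧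
      (∀ i, ηs i t = γ i) ∧
      ∀ s : Icc (0 : ℝ) b, (η s : Measure X) = Measure.sum fun i => (ηs i s : Measure X) := by
  have : SecondCountableTopology X := UniformSpace.secondCountable_of_separable X
  have hc := hη.coupled hh
  rcases isEmpty_or_nonempty M with hM | hM
  -- With no index to receive the pieces, `η t = 0`, and conservation of mass makes the whole curve
  -- vanish.
  · refine ⟨isEmptyElim, isEmptyElim, isEmptyElim, fun s => ?_⟩
    rw [Measure.sum_of_isEmpty] at hγ ⊢
    rw [← Measure.measure_univ_eq_zero, SubMeas.measure_univ_eq_of_coupled (hc s t), hγ,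
      Measure.coe_zero, Pi.zero_apply]
  · obtain ⟨σ, hσt, hσs, hσc⟩ := SubMeas.exists_splitting (u := fun s => (η s : Measure X)) hc hγ
    refine ⟨fun i s => ⟨σ s i, SubMeas.mem_dominated_of_le (η s).2 (hσs s ▸ Measure.le_sum _ i)⟩,
      fun i => SubMeas.IsSubparamCurve.of_lipschitz fun s s' hss => ?_,
      fun i => Subtype.ext (congrFun hσt i), hσs⟩
    refine (SubMeas.dominatedDist_le_of_coupled hh (hσc s' s i)).trans (le_of_eq ?_)
    rw [Subtype.edist_eq, edist_dist, Real.dist_eq, abs_of_nonneg (sub_nonneg.2 (Subtype.coe_le_coe.2 hss))]
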